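/- All rings are associative but not necessarily unital, and ideals are two-sided. A ring $R$ is called $s$-unital if for every $r \in R$ there are $s, t \in R$ with $r = rs$ and $r = tr$. For subsets $U, V$ of a ring, $UV$ denotes the set of all finite sums of elements $uv$ with $u \in U$ and $v \in V$. A ring $S$ is called prime if $S \neq \{0\}$ and, for all ideals $A$ and $B$ of $S$, $AB = \{0\}$ implies $A = \{0\}$ or $B = \{0\}$. For a ring $R$ and a group $G$, the group ring $R[G]$ is the set of formal sums $\sum_{x \in G} r_x \delta_x$ with $r_x \in R$ zero for all but finitely many $x$, with componentwise addition and with the biadditive multiplication determined by $(r\delta_x)(r'\delta_y) = rr'\delta_{xy}$ for $r,r'\in R$ and $x,y\in G$. Theorem. Let $R$ be an $s$-unital ring and let $G$ be a group. Then the group ring $R[G]$ is prime if and only if $R$ is prime and $G$ has no finite normal subgroup other than the trivial subgroup $\{e\}$. -/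

import Mathlib

open scoped Pointwise in
/-- For subsets `U`, `V` of a ring (not necessarily unital), the set `UV` of all finite sums of
elements of the form `u * v` with `u ∈ U` and `v ∈ V`. -/
def sumProd {R : Type*} [NonUnitalRing R] (U V : Set R) : Set R :=
  (AddSubmonoid.closure (U * V) : Set R)

/-- A ring `R` is s-unital if `r ∈ rR ∩ Rr` for every `r ∈ R`. -/
def IsSUnital (R : Type*) [NonUnitalRing R] : Prop :=
  ∀ r : R, (∃ s : R, r = r * s) ∧ (∃ t : R, r = t * r)

/-- A prime ideal of a (not necessarily unital) ring: a proper two-sided ideal `P` such that, for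
all two-sided ideals `A` and `B`, if `AB ⊆ P` then `A ⊆ P` or `B ⊆ P`. -/
structure IsPrimeTwoSidedIdeal {R : Type*} [NonUnitalRing R] (P : TwoSidedIdeal R) : Prop where
  ne_top : P ≠ ⊤
  le_or_le : ∀ A B : TwoSidedIdeal R,
    sumProd (A : Set R) (B : Set R) ⊆ (P : Set R) → A ≤ P ∨ B ≤ P

/-- A (not necessarily unital) ring is prime if its zero ideal is a prime ideal. -/
def IsPrimeNonUnitalRing (R : Type*) [NonUnitalRing R] : Prop :=
  IsPrimeTwoSidedIdeal (⊥ : TwoSidedIdeal R)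

/-- The group ring `R[G]` of a group `G` over a (not necessarily unital) ring `R`: the formal sums
`∑ x, r x • δ x` over `x ∈ G`, given by their finitely supported coefficient functions `r`.
(Mathlib's `MonoidAlgebra R G` requires `R` to be unital.) -/
def GroupRing (R G : Type*) [NonUnitalRing R] [Group G] : Type _ := G →₀ R

namespace GroupRing

variable {R G : Type*} [NonUnitalRing R] [Group G]

/-- Addition of formal sums is coefficientwise. -/
noncomputable instance : AddCommGroup (GroupRing R G) := inferInstanceAs (AddCommGroup (G →₀ R))

/-- The element `r δ_x` of the group ring. -/
noncomputable def single (x : G) : R →+ GroupRing R G := Finsupp.singleAddHom x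

/-- The additive map out of the group ring determined by its values on the elements `r δ_x`. -/
noncomputable def lift {M : Type*} [AddCommMonoid M] (φ : G → R →+ M) : GroupRing R G →+ M :=
  Finsupp.liftAddHom φ

theorem lift_single {M : Type*} [AddCommMonoid M] (φ : G → R →+ M) (x : G) (r : R) :
    lift φ (single x r) = φ x r :=
  Finsupp.liftAddHom_apply_single φ x r

theorem addHom_ext {M : Type*} [AddCommMonoid M] {f g : GroupRing R G →+ M}
    (h : ∀ x r, f (single x r) = g (single x r)) : f = g :=
  Finsupp.addHom_ext (f := f) (g := g) h

theorem induction_linear {p : GroupRing R G → Prop} (a : GroupRing R G) (zero : p 0)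
    (add : ∀ a b, p a → p b → p (a + b)) (single : ∀ x r, p (single x r)) : p a :=
  Finsupp.induction_linear (motive := p) a zero add single

/-- The multiplication of the group ring as a biadditive map: the biadditive extension of
`(r δ_x) (s δ_y) = (r * s) δ_(x * y)`. -/
noncomputable def mulHom : GroupRing R G →+ GroupRing R G →+ GroupRing R G :=
  lift fun x =>
    { toFun := fun r => lift fun y => (single (x * y)).comp (AddMonoidHom.mulLeft r)
      map_zero' := addHom_ext fun y s => by simp [lift_single]
      map_add' := fun r r' => addHom_ext fun y s => by simp [lift_single, add_mul] }

noncomputable instance : Mul (GroupRing R G) := ⟨fun a b => mulHom a b⟩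

theorem single_mul_single (x y : G) (r s : R) :
    single x r * single y s = single (x * y) (r * s) := by
  change mulHom (single x r) (single y s) = _
  simp [mulHom, lift_single]

noncomputable instance : NonUnitalNonAssocRing (GroupRing R G) :=
  { (inferInstance : AddCommGroup (GroupRing R G)) with
    mul := (· * ·)
    left_distrib := fun a b c => map_add (mulHom a) b c
    right_distrib := fun a b c => DFunLike.congr_fun (map_add mulHom a b) c
    zero_mul := fun a => DFunLike.congr_fun (map_zero mulHom) a
    mul_zero := fun a => map_zero (mulHom a) }

noncomputable instance : NonUnitalRing (GroupRing R G) :=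
  { (inferInstance : NonUnitalNonAssocRing (GroupRing R G)) with
    mul_assoc := fun a b c => by
      induction a using induction_linear with
      | zero => simp only [zero_mul]
      | add a a' h h' => simp only [add_mul, h, h']
      | single x r =>
        induction b using induction_linear with
        | zero => simp only [zero_mul, mul_zero]
        | add b b' h h' => simp only [add_mul, mul_add, h, h']
        | single y s =>
          induction c using induction_linear with
          | zero => simp only [mul_zero]
          | add c c' h h' => simp only [mul_add, h, h']
          | single z t => simp only [single_mul_single, mul_assoc] }

end GroupRing

/-! Over an s-unital ring, primeness can be tested on elements: `a * c * b = 0` for all `c` forces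
`a = 0` or `b = 0`. If a finite normal `N` contains `n ≠ 1`, the `N`-sum and `δ_1 - δ_n`, with a
coefficient `r ≠ 0`, violate this test.

Conversely, without such `N` the FC-center is abelian (Schur's theorem) and torsion-free, hence has
unique products. Given `a * c * b = 0` for all `c`, Neumann's covering lemma permits discarding the
part of `a` outside the FC-center (`sum_fcCenter_eq_zero`). A unique product then isolates one pair
of nonzero coefficients with `α * r * β = 0` for all `r`, against primeness of `R`. -/

/-- The FC-center of a group: the subgroup of the elements with only finitely many conjugates,
that is, with a centralizer of finite index. -/
def fcCenter (G : Type*) [Group G] : Subgroup G where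
  carrier := {x | (Subgroup.centralizer {x}).FiniteIndex}
  one_mem' := by
    have : Subgroup.centralizer {(1 : G)} = ⊤ := by
      ext g; simp [Subgroup.mem_centralizer_iff]
    simp only [Set.mem_ofPred_eq, this]
    infer_instance
  mul_mem' {x y} hx hy := by
    have hx' : (Subgroup.centralizer {x}).FiniteIndex := hx
    have hy' : (Subgroup.centralizer {y}).FiniteIndex := hy
    refine Subgroup.finiteIndex_of_le (H := Subgroup.centralizer {x} ⊓ Subgroup.centralizer {y}) ?_
    intro g
    simp only [Subgroup.mem_inf, Subgroup.mem_centralizer_iff, Set.mem_singleton_iff, forall_eq]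
    rintro ⟨h1, h2⟩
    rw [mul_assoc, h2, ← mul_assoc, h1, mul_assoc]
  inv_mem' {x} hx := by
    have hx' : (Subgroup.centralizer {x}).FiniteIndex := hx
    refine Subgroup.finiteIndex_of_le (H := Subgroup.centralizer {x}) ?_
    intro g
    simp only [Subgroup.mem_centralizer_iff, Set.mem_singleton_iff, forall_eq]
    intro h
    rw [inv_mul_eq_iff_eq_mul, ← mul_assoc, h, mul_inv_cancel_right]

/-! ### Structure of the FC-center -/

section fcCenter

variable {G : Type*} [Group G]

theorem mem_fcCenter {x : G} : x ∈ fcCenter G ↔ (Subgroup.centralizer {x}).FiniteIndex :=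
  Iff.rfl

instance : (fcCenter G).Normal where
  conj_mem x hx g := by
    have hx' : (Subgroup.centralizer {x}).FiniteIndex := hx
    rw [mem_fcCenter]
    have : ((Subgroup.centralizer {x}).comap (MulAut.conj g⁻¹).toMonoidHom).FiniteIndex :=
      ⟨by
        rw [Subgroup.index_comap_of_surjective _ (MulAut.conj g⁻¹).surjective]
        exact hx'.index_ne_zero⟩
    refine Subgroup.finiteIndex_of_le
      (H := (Subgroup.centralizer {x}).comap (MulAut.conj g⁻¹).toMonoidHom) ?_
    intro y
    simp only [Subgroup.mem_comap, Subgroup.mem_centralizer_iff, Set.mem_singleton_iff, forall_eq,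
      MulEquiv.toMonoidHom_eq_coe, MonoidHom.coe_coe, MulAut.conj_apply, inv_inv]
    intro h
    have := congrArg (fun t => g * t * g⁻¹) h
    simpa [mul_assoc] using this

theorem finite_conjugatesOf_of_mem_fcCenter {x : G} (hx : x ∈ fcCenter G) :
    (conjugatesOf x).Finite := by
  have hx' : (Subgroup.centralizer {x}).FiniteIndex := hx
  refine (Set.finite_range fun q : G ⧸ Subgroup.centralizer {x} => q.out * x * q.out⁻¹).subset ?_
  intro y hy
  obtain ⟨g, rfl⟩ := isConj_iff.1 (show IsConj x y from hy)
  refine ⟨(g : G ⧸ Subgroup.centralizer {x}), ?_⟩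
  obtain ⟨⟨u, hu⟩, h⟩ := QuotientGroup.mk_out_eq_mul (Subgroup.centralizer {x}) g
  have hu' : x * u = u * x := Subgroup.mem_centralizer_iff.1 hu x rfl
  simp only [h]
  rw [mul_assoc g u x, ← hu']
  group

theorem finite_conjugatesOfSet_of_subset_fcCenter {s : Set G} (hs : s.Finite)
    (h : s ⊆ fcCenter G) : (Group.conjugatesOfSet s).Finite :=
  hs.biUnion fun _ hx => finite_conjugatesOf_of_mem_fcCenter (h hx)

/-- A commutator depends only on the classes of its entries modulo the center. -/
theorem finite_commutatorSet_of_finiteIndex_center [(Subgroup.center G).FiniteIndex] :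
    Finite (commutatorSet G) := by
  refine Set.Finite.subset (Set.finite_range fun q : (G ⧸ Subgroup.center G) ×
    (G ⧸ Subgroup.center G) => 
    q.1.out * q.2.out * q.1.out⁻¹ * q.2.out⁻¹) ?_
  rintro _ ⟨a, b, rfl⟩
  refine ⟨(a, b), ?_⟩
  obtain ⟨⟨u, hu⟩, h⟩ := QuotientGroup.mk_out_eq_mul (Subgroup.center G) a
  obtain ⟨⟨v, hv⟩, h'⟩ := QuotientGroup.mk_out_eq_mul (Subgroup.center G) b
  simp only [h, h', commutatorElement_def, mul_inv_rev]
  rw [Subgroup.mem_center_iff] at hu hv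
  have e1 : a * u * (b * v) * (u⁻¹ * a⁻¹) = a * (u * (b * v) * u⁻¹) * a⁻¹ := by group
  have e2 : u * (b * v) * u⁻¹ = b * v := by rw [← hu]; group
  rw [e1, e2]
  have e3 : a * (b * v) * a⁻¹ * (v⁻¹ * b⁻¹) = a * b * (v * a⁻¹ * v⁻¹) * b⁻¹ := by group
  have e4 : v * a⁻¹ * v⁻¹ = a⁻¹ := by rw [← hv]; group
  rw [e3, e4]

/-- The normal closure of a finite subset of the FC-center has a center of finite index. -/
theorem finiteIndex_center_normalClosure {s : Set G} (hs : s.Finite) (h : s ⊆ fcCenter G) :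
    (Subgroup.center (Subgroup.normalClosure s)).FiniteIndex := by
  have hfin := finite_conjugatesOfSet_of_subset_fcCenter hs h
  have hle : Group.conjugatesOfSet s ⊆ fcCenter G := Group.conjugatesOfSet_subset h
  have : Finite (Group.conjugatesOfSet s) := hfin
  have hfi : (⨅ c : Group.conjugatesOfSet s, Subgroup.centralizer {(c : G)}).FiniteIndex :=
    Subgroup.finiteIndex_iInf fun c => hle c.2
  refine Subgroup.finiteIndex_of_le (H := (⨅ c : Group.conjugatesOfSet s,
    Subgroup.centralizer {(c : G)}).subgroupOf (Subgroup.normalClosure s)) ?_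
  intro u hu
  rw [Subgroup.mem_subgroupOf, ← sInf_range] at hu
  have hu' : (u : G) ∈ Subgroup.centralizer (Group.conjugatesOfSet s) := by
    rw [Subgroup.mem_centralizer_iff]
    intro c hc
    have := (Subgroup.mem_sInf.1 hu) _ ⟨⟨c, hc⟩, rfl⟩
    exact Subgroup.mem_centralizer_iff.1 this c rfl
  rw [← Subgroup.centralizer_closure] at hu'
  rw [Subgroup.mem_center_iff]
  intro g
  exact Subtype.ext (Subgroup.mem_centralizer_iff.1 hu' g g.2)

theorem commutator_normalClosure_eq_bot (hG : ∀ N : Subgroup G, N.Normal → Finite N → N = ⊥)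
    {s : Set G} (hs : s.Finite) (h : s ⊆ fcCenter G) :
    commutator (Subgroup.normalClosure s) = ⊥ := by
  have := finiteIndex_center_normalClosure hs h
  have := finite_commutatorSet_of_finiteIndex_center (G := Subgroup.normalClosure s)
  -- Schur's theorem: finitely many commutators generate a finite subgroup.
  have hcomm : Finite (commutator (Subgroup.normalClosure s)) := inferInstance
  have hfin : Finite ((commutator (Subgroup.normalClosure s)).map
      (Subgroup.normalClosure s).subtype) :=
    Set.Finite.image _ (Set.finite_coe_iff.1 hcomm)
  have := hG _ inferInstance hfin
  rwa [Subgroup.map_eq_bot_iff_of_injective _ (Subgroup.subtype_injective _)] at this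

theorem mul_comm_of_mem_normalClosure (hG : ∀ N : Subgroup G, N.Normal → Finite N → N = ⊥)
    {s : Set G} (hs : s.Finite) (h : s ⊆ fcCenter G) (x y : Subgroup.normalClosure s) :
    x * y = y * x := by
  have := commutator_normalClosure_eq_bot hG hs h
  rw [← commutatorElement_eq_one_iff_mul_comm, ← Subgroup.mem_bot, ← this]
  exact Subgroup.commutator_mem_commutator (Subgroup.mem_top _) (Subgroup.mem_top _)

theorem mul_comm_of_mem_fcCenter (hG : ∀ N : Subgroup G, N.Normal → Finite N → N = ⊥)
    {x y : G} (hx : x ∈ fcCenter G) (hy : y ∈ fcCenter G) : x * y = y * x := by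
  have h : ({x, y} : Set G) ⊆ fcCenter G := by
    rintro z (rfl | rfl)
    exacts [hx, hy]
  exact congrArg Subtype.val (mul_comm_of_mem_normalClosure hG (Set.toFinite _) h
    ⟨x, Subgroup.subset_normalClosure (by simp)⟩ ⟨y, Subgroup.subset_normalClosure (by simp)⟩)

/-- The normal closure of `x` is abelian and generated by finitely many conjugates of finite order,
so it is finite and therefore trivial. -/
theorem eq_one_of_isOfFinOrder_of_mem_fcCenter
    (hG : ∀ N : Subgroup G, N.Normal → Finite N → N = ⊥)
    {x : G} (hx : x ∈ fcCenter G) (hfin : IsOfFinOrder x) : x = 1 := by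
  have hs : ({x} : Set G) ⊆ fcCenter G := by simpa using hx
  let _ : CommGroup (Subgroup.normalClosure {x}) :=
    { (inferInstance : Group (Subgroup.normalClosure {x})) with
      mul_comm := mul_comm_of_mem_normalClosure hG (Set.finite_singleton x) hs }
  have hconj := finite_conjugatesOfSet_of_subset_fcCenter (Set.finite_singleton x) hs
  have : Group.FG (Subgroup.normalClosure {x}) :=
    (Group.fg_iff_subgroup_fg _).2 ((Subgroup.fg_iff _).2 ⟨_, rfl, hconj⟩)
  have htor : Subgroup.normalClosure {x} ≤
      (CommGroup.torsion (Subgroup.normalClosure {x})).map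
        (Subgroup.normalClosure {x}).subtype := by
    refine (Subgroup.closure_le _).2 fun c hc => ?_
    refine ⟨⟨c, Subgroup.conjugatesOfSet_subset_normalClosure hc⟩, ?_, rfl⟩
    obtain ⟨a, rfl, hac⟩ := Group.mem_conjugatesOfSet_iff.1 hc
    obtain ⟨g, rfl⟩ := isConj_iff.1 hac
    rw [SetLike.mem_coe, CommGroup.mem_torsion, ← Submonoid.isOfFinOrder_coe]
    exact (MulAut.conj g).toMonoidHom.isOfFinOrder hfin
  have hmt : IsMulTorsion (Subgroup.normalClosure {x}) := by
    intro y
    obtain ⟨z, hz, hzy⟩ := htor y.2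
    obtain rfl : z = y := Subtype.ext hzy
    exact hz
  have : Finite (Subgroup.normalClosure {x}) := CommGroup.finite_of_fg_isMulTorsion _ hmt
  have hbot := hG _ inferInstance this
  have : x ∈ Subgroup.normalClosure {x} := Subgroup.subset_normalClosure rfl
  rwa [hbot, Subgroup.mem_bot] at this

/-- A torsion-free abelian group embeds in its divisible hull, a rational vector space. -/
theorem TwoUniqueProds.of_isMulTorsionFree (A : Type*) [CommGroup A] [IsMulTorsionFree A] :
    TwoUniqueProds A := by
  have h : TwoUniqueSums (Additive A) :=
    TwoUniqueSums.of_injective_addHom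
      (DivisibleHull.coeAddMonoidHom (Additive A) : Additive A →ₙ+ DivisibleHull (Additive A))
      DivisibleHull.coe_injective inferInstance
  exact ⟨fun h1 => h.uniqueAdd_of_one_lt_card h1⟩

theorem uniqueProds_fcCenter (hG : ∀ N : Subgroup G, N.Normal → Finite N → N = ⊥) :
    UniqueProds (fcCenter G) := by
  let _ : CommGroup (fcCenter G) :=
    { (inferInstance : Group (fcCenter G)) with
      mul_comm := fun x y => Subtype.ext (mul_comm_of_mem_fcCenter hG x.2 y.2) }
  have : IsMulTorsionFree (fcCenter G) := by
    rw [CommGroup.isMulTorsionFree_iff_torsion_eq_bot, eq_bot_iff]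
    intro x hx
    have := eq_one_of_isOfFinOrder_of_mem_fcCenter hG x.2 (Submonoid.isOfFinOrder_coe.2 hx)
    exact Subgroup.mem_bot.2 (Subtype.ext this)
  have := TwoUniqueProds.of_isMulTorsionFree (fcCenter G)
  infer_instance

end fcCenter

/-! ### Elementwise primeness and common local units -/

section NonUnitalRing

variable {S : Type*} [NonUnitalRing S]

theorem mul_mem_sumProd {U V : Set S} {u v : S} (hu : u ∈ U) (hv : v ∈ V) :
    u * v ∈ sumProd U V :=
  AddSubmonoid.subset_closure (Set.mul_mem_mul hu hv)

theorem IsPrimeNonUnitalRing.exists_ne_zero (h : IsPrimeNonUnitalRing S) : ∃ r : S, r ≠ 0 := by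
  by_contra! h0
  refine h.ne_top (le_antisymm le_top fun x _ => ?_)
  rw [h0 x]
  exact TwoSidedIdeal.zero_mem _

theorem IsPrimeNonUnitalRing.eq_zero_or_eq_zero (hS : IsSUnital S) (h : IsPrimeNonUnitalRing S)
    {a b : S} (hab : ∀ c, a * c * b = 0) : a = 0 ∨ b = 0 := by
  -- Annihilators replace the ideals generated by `a` and `b`: `B` contains `b`, and `A`, defined by
  -- `x S B = 0`, contains `a`. By s-unitality `x S y = 0` implies `x * y = 0`, so `AB = 0`.
  let B : TwoSidedIdeal S := TwoSidedIdeal.mk' {y | ∀ c, a * c * y = 0}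
    (fun c => mul_zero _) (fun hx hy c => by rw [mul_add, hx c, hy c, add_zero])
    (fun hx c => by rw [mul_neg, hx c, neg_zero])
    (fun {x y} hy c => by rw [← mul_assoc, mul_assoc a, hy])
    (fun {x y} hx c => by rw [← mul_assoc, hx c, zero_mul])
  have hB {y : S} : y ∈ B ↔ ∀ c, a * c * y = 0 := TwoSidedIdeal.mem_mk' ..
  let A : TwoSidedIdeal S := TwoSidedIdeal.mk' {x | ∀ y ∈ B, ∀ c, x * c * y = 0}
    (fun y _ c => by rw [zero_mul, zero_mul])
    (fun hx hy z hz c => by rw [add_mul, add_mul, hx z hz, hy z hz, add_zero])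
    (fun hx z hz c => by rw [neg_mul, neg_mul, hx z hz c, neg_zero])
    (fun {x y} hy z hz c => by rw [mul_assoc, mul_assoc, ← mul_assoc y, hy z hz, mul_zero])
    (fun {x y} hx z hz c => by rw [mul_assoc x, hx z hz])
  have hA {x : S} : x ∈ A ↔ ∀ y ∈ B, ∀ c, x * c * y = 0 := TwoSidedIdeal.mem_mk' ..
  have hAB : sumProd (A : Set S) (B : Set S) ⊆ ((⊥ : TwoSidedIdeal S) : Set S) := by
    intro z hz
    refine AddSubmonoid.closure_induction ?_ (TwoSidedIdeal.zero_mem _)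
      (fun x y _ _ hx hy => TwoSidedIdeal.add_mem _ hx hy) hz
    rintro _ ⟨x, hx, y, hy, rfl⟩
    obtain ⟨s, hs⟩ := (hS x).1
    have hxy : x * s * y = 0 := hA.1 hx y hy s
    rw [← hs] at hxy
    exact (TwoSidedIdeal.mem_bot _).2 hxy
  refine (h.le_or_le A B hAB).imp (fun hle => ?_) (fun hle => ?_)
  · exact (TwoSidedIdeal.mem_bot _).1 (hle (hA.2 fun y hy => hB.1 hy))
  · exact (TwoSidedIdeal.mem_bot _).1 (hle (hB.2 hab))

theorem IsPrimeNonUnitalRing.of_eq_zero_or_eq_zero (h0 : ∃ r : S, r ≠ 0)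
    (h : ∀ a b : S, (∀ c, a * c * b = 0) → a = 0 ∨ b = 0) : IsPrimeNonUnitalRing S where
  ne_top htop := by
    obtain ⟨r, hr⟩ := h0
    refine hr ((TwoSidedIdeal.mem_bot _).1 ?_)
    rw [htop]
    trivial
  le_or_le A B hAB := by
    by_contra! hne
    obtain ⟨a, ha, ha0⟩ := SetLike.not_le_iff_exists.1 hne.1
    obtain ⟨b, hb, hb0⟩ := SetLike.not_le_iff_exists.1 hne.2
    rw [TwoSidedIdeal.mem_bot] at ha0 hb0
    refine (h a b fun c => ?_).elim ha0 hb0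
    exact (TwoSidedIdeal.mem_bot _).1
      (hAB (mul_mem_sumProd (TwoSidedIdeal.mul_mem_right _ _ _ ha) hb))

/-- Finitely many elements of an s-unital ring have a common left unit. -/
theorem IsSUnital.exists_left_unit (hS : IsSUnital S) (F : Finset S) :
    ∃ e : S, ∀ r ∈ F, e * r = r := by
  classical
  induction F using Finset.induction_on with
  | empty => exact ⟨0, by simp⟩
  | insert a F _ ih =>
    obtain ⟨e, he⟩ := ih
    obtain ⟨t, ht⟩ := (hS (a - e * a)).2
    -- Formally `1 - (1 - t)(1 - e)`: `1 - e` kills `F`, and `1 - t` kills what it leaves of `a`.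
    refine ⟨e + t - t * e, fun r hr => ?_⟩
    rw [sub_mul, add_mul]
    rcases Finset.mem_insert.1 hr with rfl | hr
    · rw [mul_assoc, add_sub_assoc, ← mul_sub, ← ht]
      abel
    · rw [mul_assoc, he r hr]
      abel

/-- Finitely many elements of an s-unital ring have a common right unit. -/
theorem IsSUnital.exists_right_unit (hS : IsSUnital S) (F : Finset S) :
    ∃ e : S, ∀ r ∈ F, r * e = r := by
  classical
  induction F using Finset.induction_on with
  | empty => exact ⟨0, by simp⟩
  | insert a F _ ih =>
    obtain ⟨e, he⟩ := ih
    obtain ⟨t, ht⟩ := (hS (a - a * e)).1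
    refine ⟨e + t - e * t, fun r hr => ?_⟩
    rw [mul_sub, mul_add]
    rcases Finset.mem_insert.1 hr with rfl | hr
    · rw [← mul_assoc, add_sub_assoc, ← sub_mul, ← ht]
      abel
    · rw [← mul_assoc, he r hr]
      abel

end NonUnitalRing

/-! ### Coefficients, and necessity of the two conditions -/

namespace GroupRing

variable {R G : Type*} [NonUnitalRing R] [Group G]

/-- The coefficient of a formal sum at a group element. -/
noncomputable def coeff (z : G) : GroupRing R G →+ R := Finsupp.applyAddHom z

/-- The finite set of the group elements at which a formal sum has a nonzero coefficient. -/
def support (a : GroupRing R G) : Finset G := Finsupp.support (show G →₀ R from a)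

theorem mem_support {a : GroupRing R G} {z : G} : z ∈ support a ↔ coeff z a ≠ 0 :=
  Finsupp.mem_support_iff

theorem ext {a b : GroupRing R G} (h : ∀ z, coeff z a = coeff z b) : a = b :=
  Finsupp.ext h

theorem exists_coeff_ne_zero {a : GroupRing R G} (ha : a ≠ 0) : ∃ z, coeff z a ≠ 0 := by
  by_contra! h
  exact ha (ext fun z => by rw [h z, map_zero])

theorem coeff_single [DecidableEq G] (x z : G) (r : R) :
    coeff z (single x r) = if x = z then r else 0 :=
  Finsupp.single_apply

theorem coeff_single_self (x : G) (r : R) : coeff x (single x r) = r :=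
  Finsupp.single_eq_same

theorem single_eq_zero {x : G} {r : R} : single x r = 0 ↔ r = 0 :=
  Finsupp.single_eq_zero

theorem sum_single (a : GroupRing R G) : ∑ g ∈ support a, single g (coeff g a) = a :=
  Finsupp.sum_single (show G →₀ R from a)

theorem coeff_single_mul (x z : G) (r : R) (b : GroupRing R G) :
    coeff z (single x r * b) = r * coeff (x⁻¹ * z) b := by
  classical
  induction b using induction_linear with
  | zero => simp
  | add b b' h h' => rw [mul_add, map_add, map_add, mul_add, h, h']
  | single y s => simp [single_mul_single, coeff_single, eq_inv_mul_iff_mul_eq]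

theorem coeff_mul_single (x z : G) (r : R) (a : GroupRing R G) :
    coeff z (a * single x r) = coeff (z * x⁻¹) a * r := by
  classical
  induction a using induction_linear with
  | zero => simp
  | add b b' h h' => rw [add_mul, map_add, map_add, add_mul, h, h']
  | single y s => simp [single_mul_single, coeff_single, eq_mul_inv_iff_mul_eq]

theorem coeff_mul (z : G) (a b : GroupRing R G) :
    coeff z (a * b) = ∑ g ∈ support a, coeff g a * coeff (g⁻¹ * z) b := by
  conv_lhs => rw [← sum_single a]
  simp only [Finset.sum_mul, map_sum, coeff_single_mul]

theorem isSUnital (hR : IsSUnital R) : IsSUnital (GroupRing R G) := by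
  classical
  intro a
  obtain ⟨s, hs⟩ := hR.exists_right_unit ((support a).image fun g => coeff g a)
  obtain ⟨t, ht⟩ := hR.exists_left_unit ((support a).image fun g => coeff g a)
  refine ⟨⟨single 1 s, ext fun z => ?_⟩, ⟨single 1 t, ext fun z => ?_⟩⟩
  · rw [coeff_mul_single, inv_one, mul_one]
    by_cases hz : z ∈ support a
    · exact (hs _ (Finset.mem_image_of_mem _ hz)).symm
    · rw [mem_support, not_not] at hz
      rw [hz, zero_mul]
  · rw [coeff_single_mul, inv_one, one_mul]
    by_cases hz : z ∈ support a
    · exact (ht _ (Finset.mem_image_of_mem _ hz)).symm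
    · rw [mem_support, not_not] at hz
      rw [hz, mul_zero]

theorem isPrimeNonUnitalRing_coefficients (hR : IsSUnital R)
    (h : IsPrimeNonUnitalRing (GroupRing R G)) : IsPrimeNonUnitalRing R := by
  refine .of_eq_zero_or_eq_zero ?_ fun a b hab => ?_
  · obtain ⟨a, ha⟩ := h.exists_ne_zero
    obtain ⟨z, hz⟩ := exists_coeff_ne_zero ha
    exact ⟨_, hz⟩
  · have := h.eq_zero_or_eq_zero (isSUnital hR) (a := single (1 : G) a) (b := single 1 b)
      fun c => ext fun z => by
        rw [coeff_mul_single, coeff_single_mul, hab, map_zero]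
    rwa [single_eq_zero, single_eq_zero] at this

theorem eq_bot_of_normal_of_finite (hR : IsSUnital R) (h : IsPrimeNonUnitalRing (GroupRing R G))
    (N : Subgroup G) (hN : N.Normal) (hfin : Finite N) : N = ⊥ := by
  classical
  have := Fintype.ofFinite N
  obtain ⟨r, hr⟩ := (isPrimeNonUnitalRing_coefficients hR h).exists_ne_zero
  refine (Subgroup.eq_bot_iff_forall _).2 fun n hn => ?_
  by_contra hn1
  have hprod : ∀ c : GroupRing R G,
      (∑ m : N, single (m : G) r) * c * (single 1 r - single n r) = 0 := by
    intro c
    induction c using induction_linear with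
    | zero => rw [mul_zero, zero_mul]
    | add b b' h h' => rw [mul_add, add_mul, h, h', add_zero]
    | single x t =>
      simp only [Finset.sum_mul, mul_sub, single_mul_single, mul_one]
      rw [sub_eq_zero]
      -- Since `x * n = (x * n * x⁻¹) * x` and the conjugate lies in `N`, the factor `n` only
      -- permutes the sum over `N`.
      refine Fintype.sum_equiv (Equiv.mulRight (⟨x * n * x⁻¹, hN.conj_mem n hn x⟩ : N)⁻¹) _ _
        fun m => ?_
      congr 1
      simp [mul_assoc]
  rcases h.eq_zero_or_eq_zero (isSUnital hR) hprod with h0 | h0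
  · have := congrArg (coeff 1) h0
    rw [map_sum, Finset.sum_eq_single (1 : N)] at this
    · exact hr (by simpa [coeff_single] using this)
    · intro m _ hm
      rw [coeff_single, if_neg (by simpa using hm)]
    · simp
  · have := congrArg (coeff 1) h0
    rw [map_sub, coeff_single_self, coeff_single, if_neg hn1, sub_zero, map_zero] at this
    exact hr this

end GroupRing

/-! ### Avoiding conjugates by Neumann's lemma -/

open scoped Pointwise in
/-- By B. H. Neumann's covering lemma, a subgroup of finite index contains an element that
conjugates no member of a finite set outside the FC-center into a given finite set. -/
theorem exists_forall_conj_ne {G : Type*} [Group G] (W : Subgroup G) [W.FiniteIndex]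
    (S T : Finset G) (hS : ∀ g ∈ S, g ∉ fcCenter G) :
    ∃ u ∈ W, ∀ g ∈ S, ∀ t ∈ T, u⁻¹ * g * u ≠ t := by
  classical
  by_contra! hcon
  have := Fintype.ofFinite (G ⧸ W)
  let P : G × G → Prop := fun p => ∃ u, u⁻¹ * p.1 * u = p.2
  let v : G × G → G := fun p => if h : P p then h.choose else 1
  have hv {p : G × G} (h : P p) : (v p)⁻¹ * p.1 * v p = p.2 := by
    simp only [v, dif_pos h]
    exact h.choose_spec
  -- The solutions `u` of `u⁻¹ * g * u = t` form the coset `v (g, t) • C(t)`. If every `u ∈ W`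
  -- solved such an equation, the translates of these cosets by representatives of `G ⧸ W` would
  -- cover `G`. Some `C(t)` would then have finite index, putting `t` and its conjugate `g` in the
  -- FC-center.
  have hcover : ⋃ i ∈ (Finset.univ : Finset (G ⧸ W)) ×ˢ ((S ×ˢ T).filter P),
      (i.1.out * v i.2) • (Subgroup.centralizer {i.2.2} : Set G) = Set.univ := by
    refine Set.eq_univ_of_forall fun x => ?_
    have hxW : (x : G ⧸ W).out⁻¹ * x ∈ W :=
      QuotientGroup.eq.1 (QuotientGroup.out_eq' (x : G ⧸ W))
    obtain ⟨g, hg, t, ht, hgt⟩ := hcon _ hxW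
    have hP : P (g, t) := ⟨_, hgt⟩
    refine Set.mem_iUnion₂.2 ⟨((x : G ⧸ W), (g, t)), by simp [hg, ht, hP], ?_⟩
    rw [Set.mem_smul_set_iff_inv_smul_mem, SetLike.mem_coe, Subgroup.mem_centralizer_iff]
    rintro _ ⟨⟩
    change t * _ = _ * t
    have hvt : (v (g, t))⁻¹ * g = t * (v (g, t))⁻¹ := by
      have h : (v (g, t))⁻¹ * g * v (g, t) = t := hv hP
      exact eq_mul_inv_of_mul_eq h
    have hut : g * ((x : G ⧸ W).out⁻¹ * x) = (x : G ⧸ W).out⁻¹ * x * t := by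
      rw [← hgt]
      group
    rw [smul_eq_mul, mul_inv_rev, mul_assoc, ← mul_assoc t, ← hvt, mul_assoc, hut]
    simp only [mul_assoc]
  obtain ⟨k, hk, hfi⟩ := Subgroup.exists_finiteIndex_of_leftCoset_cover hcover
  obtain ⟨hkS, hP⟩ := Finset.mem_filter.1 (Finset.mem_product.1 hk).2
  refine hS _ (Finset.mem_product.1 hkS).1 ?_
  have hmem : k.2.2 ∈ fcCenter G := hfi
  rw [← hv hP] at hmem
  have := (inferInstance : (fcCenter G).Normal).conj_mem _ hmem (v k.2)
  simpa [mul_assoc] using this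

/-! ### Sufficiency of the two conditions -/

namespace GroupRing

variable {R G : Type*} [NonUnitalRing R] [Group G]

theorem sum_fcCenter_eq_zero [DecidablePred (· ∈ fcCenter G)] {a b : GroupRing R G} {r : R}
    (h : ∀ x : G, a * single x r * b = 0) (z : G) :
    ∑ g ∈ (support a).filter (· ∈ fcCenter G), coeff g a * (r * coeff (g⁻¹ * z) b) = 0 := by
  classical
  let F := (support a).filter (· ∈ fcCenter G)
  let W : Subgroup G := ⨅ c : F, Subgroup.centralizer {(c : G)}
  have : W.FiniteIndex := Subgroup.finiteIndex_iInf fun c => (Finset.mem_filter.1 c.2).2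
  -- At `u * z`, terms with `g` in the FC-center lose `u`, as `u` commutes with `g`. Any other
  -- nonzero term needs `y = u⁻¹ * g⁻¹ * u * z` in the support of `b`, that is, `u⁻¹ * g * u = z *
  -- y⁻¹`, which `u` avoids.
  obtain ⟨u, hu, hne⟩ := exists_forall_conj_ne W ((support a).filter (· ∉ fcCenter G))
    ((support b).image fun y => z * y⁻¹) fun g hg => (Finset.mem_filter.1 hg).2
  have hcoeff := congrArg (coeff (u * z)) (h u)
  rw [mul_assoc, coeff_mul, map_zero, ← Finset.sum_filter_add_sum_filter_not _ (· ∈ fcCenter G),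
    Finset.sum_eq_zero (s := (support a).filter (· ∉ fcCenter G)), add_zero] at hcoeff
  · rw [← hcoeff]
    refine Finset.sum_congr rfl fun g hg => ?_
    have hug : g * u = u * g := Subgroup.mem_centralizer_iff.1
      ((Subgroup.mem_iInf.1 hu) ⟨g, hg⟩) g rfl
    rw [coeff_single_mul]
    have harg : u⁻¹ * (g⁻¹ * (u * z)) = g⁻¹ * z := by
      rw [inv_mul_eq_iff_eq_mul, inv_mul_eq_iff_eq_mul, ← mul_assoc, ← mul_assoc, hug,
        mul_assoc u, mul_inv_cancel, mul_one]
    rw [harg]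
  · intro g hg
    rw [coeff_single_mul]
    by_contra h0
    have hsupp : u⁻¹ * (g⁻¹ * (u * z)) ∈ support b := by
      rw [mem_support]
      intro h1
      exact h0 (by rw [h1, mul_zero, mul_zero])
    refine hne g hg _ (Finset.mem_image_of_mem _ hsupp) ?_
    group

theorem exists_coeff_one_mul_single_ne_zero (hR : IsSUnital R) {a : GroupRing R G} (ha : a ≠ 0) :
    ∃ (x : G) (s : R), coeff 1 (a * single x s) ≠ 0 := by
  obtain ⟨g, hg⟩ := exists_coeff_ne_zero ha
  obtain ⟨s, hs⟩ := (hR (coeff g a)).1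
  refine ⟨g⁻¹, s, ?_⟩
  rwa [coeff_mul_single, inv_inv, one_mul, ← hs]

theorem exists_coeff_one_single_mul_ne_zero (hR : IsSUnital R) {a : GroupRing R G} (ha : a ≠ 0) :
    ∃ (x : G) (s : R), coeff 1 (single x s * a) ≠ 0 := by
  obtain ⟨g, hg⟩ := exists_coeff_ne_zero ha
  obtain ⟨s, hs⟩ := (hR (coeff g a)).2
  refine ⟨g⁻¹, s, ?_⟩
  rwa [coeff_single_mul, inv_inv, mul_one, ← hs]

theorem exists_mul_mul_ne_zero (hR : IsSUnital R) (hP : IsPrimeNonUnitalRing R)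
    (hG : ∀ N : Subgroup G, N.Normal → Finite N → N = ⊥) {a b : GroupRing R G}
    (ha : coeff 1 a ≠ 0) (hb : coeff 1 b ≠ 0) : ∃ c, a * c * b ≠ 0 := by
  classical
  by_contra! h
  have := uniqueProds_fcCenter hG
  -- The nonzero coefficients at `1` make both restricted supports nonempty.
  obtain ⟨g₀, hg₀, h₀, hh₀, huniq⟩ := UniqueProds.uniqueMul_of_nonempty
    (A := (support a).subtype (· ∈ fcCenter G)) (B := (support b).subtype (· ∈ fcCenter G))
    ⟨1, by simpa [mem_support] using ha⟩ ⟨1, by simpa [mem_support] using hb⟩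
  rw [Finset.mem_subtype] at hg₀ hh₀
  refine (hP.eq_zero_or_eq_zero hR (a := coeff (g₀ : G) a) (b := coeff (h₀ : G) b)
    fun r => ?_).elim (mem_support.1 hg₀) (mem_support.1 hh₀)
  have hsum := sum_fcCenter_eq_zero (fun x => h (single x r)) ((g₀ : G) * h₀)
  rw [Finset.sum_eq_single (g₀ : G), inv_mul_cancel_left] at hsum
  · rwa [mul_assoc]
  · intro g hg hne
    obtain ⟨hga, hgΔ⟩ := Finset.mem_filter.1 hg
    by_contra h0
    have hsupp : g⁻¹ * (g₀ * h₀) ∈ support b := by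
      rw [mem_support]
      intro h1
      exact h0 (by rw [h1, mul_zero, mul_zero])
    have hmem : g⁻¹ * (g₀ * h₀) ∈ fcCenter G :=
      mul_mem (inv_mem hgΔ) (mul_mem g₀.2 h₀.2)
    have := huniq (a := ⟨g, hgΔ⟩) (b := ⟨_, hmem⟩) (by simpa using hga) (by simpa using hsupp)
      (Subtype.ext (by simp))
    exact hne (congrArg Subtype.val this.1)
  · intro hg
    exact (hg (Finset.mem_filter.2 ⟨hg₀, g₀.2⟩)).elim

theorem isPrimeNonUnitalRing (hR : IsSUnital R) (hP : IsPrimeNonUnitalRing R)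
    (hG : ∀ N : Subgroup G, N.Normal → Finite N → N = ⊥) :
    IsPrimeNonUnitalRing (GroupRing R G) := by
  refine .of_eq_zero_or_eq_zero ?_ fun a b hab => ?_
  · obtain ⟨r, hr⟩ := hP.exists_ne_zero
    exact ⟨single 1 r, fun h => hr (single_eq_zero.1 h)⟩
  · by_contra! hne
    obtain ⟨x, s, hx⟩ := exists_coeff_one_mul_single_ne_zero hR hne.1
    obtain ⟨y, t, hy⟩ := exists_coeff_one_single_mul_ne_zero hR hne.2
    obtain ⟨c, hc⟩ := exists_mul_mul_ne_zero hR hP hG hx hy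
    refine hc ?_
    rw [← mul_assoc, mul_assoc a, mul_assoc a, hab]

end GroupRing

theorem theorem1p5 {R : Type*} [NonUnitalRing R] {G : Type*} [Group G] (hR : IsSUnital R) :
    IsPrimeNonUnitalRing (GroupRing R G) ↔
      IsPrimeNonUnitalRing R ∧ ∀ N : Subgroup G, N.Normal → Finite N → N = ⊥ :=
  ⟨fun h => ⟨GroupRing.isPrimeNonUnitalRing_coefficients hR h,
    GroupRing.eq_bot_of_normal_of_finite hR h⟩,
    fun h => GroupRing.isPrimeNonUnitalRing hR h.1 h.2⟩
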